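/- A graph $G$ is $(a,b)$-choosable if for every assignment $L$ of a set $L(x)$ of $a$ colours to each vertex $x$ of $G$ one can choose sets $\phi(x)\subseteq L(x)$ with $|\phi(x)|=b$ for every vertex $x$, such that $\phi(x)\cap\phi(y)=\emptyset$ for every edge $xy$ of $G$. Let $\Theta_{k_1,\dots,k_q}$ denote the graph consisting of internally vertex-disjoint paths of lengths $k_1,\dots,k_q$ (numbers of edges) connecting two distinct vertices $u$ and $v$. **Theorem.** Let $G$ be one of the following graphs: 1. $\Theta_{2r,2s,2t}$ with integers $r,s,t>1$; 2. $\Theta_{2r+1,2s+1,2t+1}$ with integers $r,s,t>0$; 3. $\Theta_{2,2,2,2t}$ with an integer $t\ge 1$. Then $G$ is $(2m+1,m)$-choosable for every positive integer $m$. -/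

import Mathlib

universe u w

/-- `G` is `(a, b)`-choosable: for every assignment `L` of sets of `a` colours to the vertices, there
is an `(L, b)`-colouring, that is, a choice of `b`-element sets `φ v ⊆ L v` such that `φ x` and
`φ y` are disjoint whenever `x` and `y` are adjacent. The colours may come from any type. -/
def IsChoosable {V : Type u} (G : SimpleGraph V) (a b : ℕ) : Prop :=
  ∀ (C : Type w) (L : V → Finset C), (∀ v, (L v).card = a) →
    ∃ φ : V → Finset C, (∀ v, (φ v).card = b) ∧ (∀ v, φ v ⊆ L v) ∧
      ∀ x y, G.Adj x y → Disjoint (φ x) (φ y)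

/-- The vertices of the generalised theta graph with path lengths `k 0, …, k (q - 1)`: two branch
vertices `u`, `v`, and `k i - 1` internal vertices on the `i`-th path (so all the internal vertices
of all the paths are distinct). -/
inductive ThetaVertex {q : ℕ} (k : Fin q → ℕ) : Type
  | u : ThetaVertex k
  | v : ThetaVertex k
  | inner (i : Fin q) (j : Fin (k i - 1)) : ThetaVertex k

/-- The vertex in position `j` on the `i`-th path, for `0 ≤ j ≤ k i`: position `0` is `u`,
position `k i` is `v`, and the positions `1, …, k i - 1` are the internal vertices. -/
def thetaPath {q : ℕ} (k : Fin q → ℕ) (i : Fin q) (j : ℕ) : ThetaVertex k :=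
  if j = 0 then ThetaVertex.u
  else if h : j - 1 < k i - 1 then ThetaVertex.inner i ⟨j - 1, h⟩
  else ThetaVertex.v

/-- The generalised theta graph `Θ_{k 0, …, k (q - 1)}` (for positive path lengths): internally
vertex-disjoint paths of lengths `k 0, …, k (q - 1)` joining `u` and `v`. The edges are the pairs of
consecutive vertices on one of the paths. -/
def thetaGraph {q : ℕ} (k : Fin q → ℕ) : SimpleGraph (ThetaVertex k) :=
  SimpleGraph.fromRel fun x y =>
    ∃ i : Fin q, ∃ j : ℕ, j < k i ∧ x = thetaPath k i j ∧ y = thetaPath k i (j + 1)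

/-!
Fix the colours `A` and `B` of the two branch vertices. Along one path, let every inner vertex keep
the colours of its list that the next vertex has not kept, starting from `B`. The colouring extends
to the path as soon as `A` meets the first kept set in no more colours than the kept sets have to
spare altogether, and this is one linear inequality in the indicators of `A`, `B` and `A ∩ B`.

If all lengths are odd, disjoint `A` and `B` are wanted. After identifying the two lists at the
branch vertices by a bijection fixing their common colours, they are found by rounding an extreme
point of a linear program: it has few fractional coordinates, so rounding costs little.

If all lengths are even, take `A = S ∩ U` and `B = S ∩ V` for a set `S` of colours from the lists
`U` and `V` of the branch vertices, so that each path bounds the weight of `S`. The constant vector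
`m / (2 * m + 1)` is feasible for the corresponding linear program, some extreme point has at most
six fractional coordinates, and it has a rounding with the exact sums over `U` and `V` that is close
to it in the Euclidean norm. The Cauchy–Schwarz inequality then bounds the change of each weight.
-/

section Path

variable {C : Type w}

/-- The path with `n` inner vertices, whose lists are `L 0, …, L (n - 1)`, and with ends coloured
`A` and `B` has an `m`-fold list colouring `φ`. The ends are the positions `0` and `n + 1`, so the
vertex in position `j + 1` has the list `L j`. -/
def PathColourable (m : ℕ) (A B : Finset C) (n : ℕ) (L : ℕ → Finset C) : Prop :=
  ∃ φ : ℕ → Finset C, φ 0 = A ∧ φ (n + 1) = B ∧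
    (∀ j < n, φ (j + 1) ⊆ L j ∧ (φ (j + 1)).card = m) ∧
    ∀ j ≤ n, Disjoint (φ j) (φ (j + 1))

theorem pathColourable_zero {A B : Finset C} (h : Disjoint A B) (m : ℕ) (L : ℕ → Finset C) :
    PathColourable m A B 0 L :=
  ⟨fun j => if j = 0 then A else B, rfl, rfl, by simp, fun j hj => by simpa [Nat.le_zero.1 hj]⟩

theorem PathColourable.cons {m n : ℕ} {A T B : Finset C} {L : ℕ → Finset C}
    (h : PathColourable m T B n fun j => L (j + 1)) (hT : T ⊆ L 0) (hTm : T.card = m)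
    (hAT : Disjoint A T) : PathColourable m A B (n + 1) L := by
  obtain ⟨φ, rfl, hB, hφ, hdisj⟩ := h
  refine ⟨fun j => j.casesOn A φ, rfl, hB, fun j hj => ?_, fun j hj => ?_⟩
  · cases j with
    | zero => exact ⟨hT, hTm⟩
    | succ j => exact hφ j (by omega)
  · cases j with
    | zero => exact hAT
    | succ j => exact hdisj j (by omega)

variable [DecidableEq C]

/-- Greedy residues of a path: starting from the colour set `B` behind the far end, every vertex
keeps the colours of its list that the next vertex has not kept. This is the set kept by the first
of the `n` vertices with lists `L 0, …, L (n - 1)`. -/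
def residue (B : Finset C) : ℕ → (ℕ → Finset C) → Finset C
  | 0, _ => B
  | n + 1, L => L 0 \ residue B n (fun j => L (j + 1))

/-- The sum of `|residue| - m` over the vertices of the path: the number of colours that the
residues can spare altogether when every vertex needs `m` of them. -/
def excess (m : ℕ) (B : Finset C) : ℕ → (ℕ → Finset C) → ℤ
  | 0, _ => 0
  | n + 1, L => ((residue B (n + 1) L).card : ℤ) - m + excess m B n (fun j => L (j + 1))

theorem pathColourable_one {m : ℕ} {A B : Finset C} {L : ℕ → Finset C}
    (h : (L 0 ∩ (A ∪ B)).card + m ≤ (L 0).card) : PathColourable m A B 1 L := by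
  have hm : m ≤ (L 0 \ (A ∪ B)).card := by
    have := Finset.card_inter_add_card_sdiff (L 0) (A ∪ B)
    omega
  obtain ⟨T, hT, hTm⟩ := Finset.exists_subset_card_eq hm
  rw [Finset.subset_sdiff, Finset.disjoint_union_right] at hT
  exact (pathColourable_zero hT.2.2 m _).cons hT.1 hTm hT.2.1.symm

theorem one_add_excess_le_excess_add_two {m : ℕ} (B : Finset C) (n : ℕ) {L : ℕ → Finset C}
    (hL : 2 * m + 1 ≤ (L 0).card) :
    1 + excess m B n (fun j => L (j + 2)) ≤ excess m B (n + 2) L := by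
  have hcard : (L 0).card ≤ (residue B (n + 2) L).card
      + (residue B (n + 1) (fun j => L (j + 1))).card :=
    Finset.card_le_card_sdiff_add_card
  have hexc : excess m B (n + 2) L = ((residue B (n + 2) L).card : ℤ) - m +
      (((residue B (n + 1) (fun j => L (j + 1))).card : ℤ) - m +
        excess m B n (fun j => L (j + 2))) := rfl
  omega

theorem le_excess_even {m : ℕ} (B : Finset C) (a : ℕ) {L : ℕ → Finset C}
    (hL : ∀ j, 2 * m + 1 ≤ (L j).card) : (a : ℤ) ≤ excess m B (2 * a) L := by
  induction a generalizing L with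
  | zero => simp [excess]
  | succ a ih =>
    have hstep := one_add_excess_le_excess_add_two B (2 * a) (hL 0)
    have htail := ih (L := fun j => L (j + 2)) fun j => hL _
    push_cast
    exact (by omega : (a : ℤ) + 1 ≤ 1 + _).trans hstep

theorem le_excess_odd {m : ℕ} (B : Finset C) (a : ℕ) {L : ℕ → Finset C}
    (hL : ∀ j, 2 * m + 1 ≤ (L j).card) :
    (a : ℤ) + m + 1 - B.card ≤ excess m B (2 * a + 1) L := by
  induction a generalizing L with
  | zero =>
    have hcard : (L 0).card ≤ (L 0 \ B).card + B.card := Finset.card_le_card_sdiff_add_card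
    have := hL 0
    simp only [excess, residue]
    omega
  | succ a ih =>
    have hstep := one_add_excess_le_excess_add_two B (2 * a + 1) (hL 0)
    have htail := ih (L := fun j => L (j + 2)) fun j => hL _
    push_cast
    exact (by omega : (a : ℤ) + 1 + m + 1 - B.card ≤ 1 + _).trans hstep

theorem excess_nonneg {m : ℕ} {B : Finset C} (hB : B.card ≤ m) (n : ℕ) {L : ℕ → Finset C}
    (hL : ∀ j, 2 * m + 1 ≤ (L j).card) : 0 ≤ excess m B n L := by
  obtain ⟨a, rfl | rfl⟩ := n.even_or_odd'
  · have := le_excess_even B a hL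
    omega
  · have := le_excess_odd B a hL
    omega

theorem exists_subset_card_inter_le {M Z : Finset C} {m s : ℕ} (hM : m ≤ M.card)
    (h : m ≤ (M \ Z).card + s) : ∃ T ⊆ M, T.card = m ∧ (T ∩ Z).card ≤ s := by
  rcases le_total m (M \ Z).card with hm | hm
  · obtain ⟨T, hT, hTm⟩ := Finset.exists_subset_card_eq hm
    have hTZ : T ∩ Z = ∅ :=
      Finset.disjoint_iff_inter_eq_empty.1 (Finset.subset_sdiff.1 hT).2
    exact ⟨T, hT.trans Finset.sdiff_subset, hTm, by simp [hTZ]⟩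
  · obtain ⟨T, hT, hTM, hTm⟩ :=
      Finset.exists_subsuperset_card_eq (Finset.sdiff_subset : M \ Z ⊆ M) hm hM
    refine ⟨T, hTM, hTm, ?_⟩
    have hsplit : (T ∩ Z).card + (T \ Z).card = T.card := Finset.card_inter_add_card_sdiff T Z
    have hle : (M \ Z).card ≤ (T \ Z).card :=
      Finset.card_le_card (Finset.subset_sdiff.2 ⟨hT, Finset.sdiff_disjoint⟩)
    omega

theorem pathColourable_of_card_inter_residue_le {m : ℕ} {A B : Finset C} (hA : A.card ≤ m)
    (hB : B.card ≤ m) (n : ℕ) {L : ℕ → Finset C} (hL : ∀ j, 2 * m + 1 ≤ (L j).card)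
    (h : ((A ∩ residue B n L).card : ℤ) ≤ excess m B n L) : PathColourable m A B n L := by
  induction n generalizing A L with
  | zero =>
    refine pathColourable_zero ?_ m L
    rw [Finset.disjoint_iff_inter_eq_empty, ← Finset.card_eq_zero]
    simp only [residue, excess] at h
    omega
  | succ n ih =>
    set L' : ℕ → Finset C := fun j => L (j + 1)
    have hL' : ∀ j, 2 * m + 1 ≤ (L' j).card := fun j => hL _
    obtain ⟨s, hs⟩ := Int.eq_ofNat_of_zero_le (excess_nonneg hB n hL')
    set Z := residue B n L'
    have hexc : excess m B (n + 1) L = ((L 0 \ Z).card : ℤ) - m + s := by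
      rw [excess, hs]
      rfl
    have hsplit : (A ∩ (L 0 \ Z)).card + ((L 0 \ A) \ Z).card = (L 0 \ Z).card := by
      rw [← Finset.card_inter_add_card_sdiff (L 0 \ Z) A, Finset.inter_comm, sdiff_right_comm]
    have hcard : (L 0).card ≤ (L 0 \ A).card + A.card := Finset.card_le_card_sdiff_add_card
    have hL0 := hL 0
    rw [hexc, show residue B (n + 1) L = L 0 \ Z from rfl] at h
    obtain ⟨T, hT, hTm, hTZ⟩ :=
      exists_subset_card_inter_le (M := L 0 \ A) (Z := Z) (m := m) (s := s) (by omega) (by omega)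
    rw [Finset.subset_sdiff] at hT
    exact (ih hTm.le hL' (by rw [hs]; exact_mod_cast hTZ)).cons hT.1 hTm hT.2.symm

/-- The dependence of the residue and the excess of a path with an even number `n` of inner vertices
on the colours `B ⊆ V` of the far end: a colour of `B` costs one unit of excess if it is in `Y`, and
it is added to the residue if it is in `Λ`. -/
structure EvenDependence (m : ℕ) (V : Finset C) (n : ℕ) (L : ℕ → Finset C) (Y Λ : Finset C) :
    Prop where
  costly_subset : Y ⊆ V
  linked_subset : Λ ⊆ V
  disjoint_residue : Disjoint (residue ∅ n L) Λ
  disjoint_costly : Disjoint Y Λ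
  residue_eq {B : Finset C} (hB : B ⊆ V) : residue B n L = residue ∅ n L ∪ B ∩ Λ
  excess_eq {B : Finset C} (hB : B ⊆ V) : excess m B n L = excess m ∅ n L - (B ∩ Y).card

/-- The dependence of the residue and the excess of a path with an odd number `n` of inner vertices
on the colours `B ⊆ V` of the far end: a colour of `B` costs one unit of excess if it is in `Y`, and
it is removed from the residue if it is in `Λ`. -/
structure OddDependence (m : ℕ) (V : Finset C) (n : ℕ) (L : ℕ → Finset C) (Y Λ : Finset C) :
    Prop where
  costly_subset : Y ⊆ V
  linked_subset : Λ ⊆ V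
  linked_subset_residue : Λ ⊆ residue ∅ n L
  linked_subset_costly : Λ ⊆ Y
  residue_eq {B : Finset C} (hB : B ⊆ V) : residue B n L = residue ∅ n L \ (B ∩ Λ)
  excess_eq {B : Finset C} (hB : B ⊆ V) : excess m B n L = excess m ∅ n L - (B ∩ Y).card

theorem evenDependence_zero (m : ℕ) (V : Finset C) (L : ℕ → Finset C) :
    EvenDependence m V 0 L ∅ V where
  costly_subset := Finset.empty_subset V
  linked_subset := subset_rfl
  disjoint_residue := Finset.disjoint_empty_left V
  disjoint_costly := Finset.disjoint_empty_left V
  residue_eq hB := by simp [residue, Finset.inter_eq_left.2 hB]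
  excess_eq _ := by simp [excess]

theorem EvenDependence.succ {m n : ℕ} {V Y Λ : Finset C} {L : ℕ → Finset C}
    (h : EvenDependence m V n (fun j => L (j + 1)) Y Λ) :
    OddDependence m V (n + 1) L (Y ∪ L 0 ∩ Λ) (L 0 ∩ Λ) := by
  have hsub : L 0 ∩ Λ ⊆ residue ∅ (n + 1) L :=
    Finset.subset_sdiff.2 ⟨Finset.inter_subset_left,
      h.disjoint_residue.symm.mono_left Finset.inter_subset_right⟩
  have hres {B : Finset C} (hB : B ⊆ V) :
      residue B (n + 1) L = residue ∅ (n + 1) L \ (B ∩ (L 0 ∩ Λ)) := by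
    simp only [residue, h.residue_eq hB]
    grind
  refine ⟨Finset.union_subset h.costly_subset (Finset.inter_subset_right.trans h.linked_subset),
    Finset.inter_subset_right.trans h.linked_subset, hsub, Finset.subset_union_right, hres,
    fun {B} hB => ?_⟩
  have hcard : (residue ∅ (n + 1) L \ (B ∩ (L 0 ∩ Λ))).card + (B ∩ (L 0 ∩ Λ)).card =
      (residue ∅ (n + 1) L).card :=
    Finset.card_sdiff_add_card_eq_card (Finset.inter_subset_right.trans hsub)
  have hcost : (B ∩ (Y ∪ L 0 ∩ Λ)).card = (B ∩ Y).card + (B ∩ (L 0 ∩ Λ)).card := by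
    rw [Finset.inter_union_distrib_left, Finset.card_union_of_disjoint]
    exact h.disjoint_costly.mono Finset.inter_subset_right
      (Finset.inter_subset_right.trans Finset.inter_subset_right)
  rw [excess, excess, hres hB, h.excess_eq hB, hcost]
  omega

theorem OddDependence.succ {m n : ℕ} {V Y Λ : Finset C} {L : ℕ → Finset C}
    (h : OddDependence m V n (fun j => L (j + 1)) Y Λ) :
    EvenDependence m V (n + 1) L (Y \ (L 0 ∩ Λ)) (L 0 ∩ Λ) := by
  have hdisj : Disjoint (residue ∅ (n + 1) L) (L 0 ∩ Λ) :=
    Finset.sdiff_disjoint.mono_right (Finset.inter_subset_right.trans h.linked_subset_residue)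
  have hres {B : Finset C} (hB : B ⊆ V) :
      residue B (n + 1) L = residue ∅ (n + 1) L ∪ B ∩ (L 0 ∩ Λ) := by
    have := h.linked_subset_residue
    simp only [residue, h.residue_eq hB]
    grind
  refine ⟨Finset.sdiff_subset.trans h.costly_subset,
    Finset.inter_subset_right.trans h.linked_subset, hdisj, Finset.sdiff_disjoint, hres,
    fun {B} hB => ?_⟩
  have hcard : (residue ∅ (n + 1) L ∪ B ∩ (L 0 ∩ Λ)).card =
      (residue ∅ (n + 1) L).card + (B ∩ (L 0 ∩ Λ)).card :=
    Finset.card_union_of_disjoint (hdisj.mono_right Finset.inter_subset_right)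
  have hcost : (B ∩ (Y \ (L 0 ∩ Λ))).card + (B ∩ (L 0 ∩ Λ)).card = (B ∩ Y).card := by
    rw [← Finset.inter_sdiff_assoc]
    have hsub : B ∩ (L 0 ∩ Λ) ⊆ B ∩ Y :=
      Finset.inter_subset_inter_left (Finset.inter_subset_right.trans h.linked_subset_costly)
    rw [← Finset.card_sdiff_add_card_eq_card hsub]
    congr 2
    grind
  rw [excess, excess, hres hB, h.excess_eq hB, hcard]
  omega

theorem exists_evenDependence (m : ℕ) (V : Finset C) (a : ℕ) (L : ℕ → Finset C) :
    ∃ Y Λ, EvenDependence m V (2 * a) L Y Λ := by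
  induction a generalizing L with
  | zero => exact ⟨_, _, evenDependence_zero m V L⟩
  | succ a ih =>
    obtain ⟨Y, Λ, h⟩ := ih fun j => L (j + 2)
    exact ⟨_, _, (EvenDependence.succ (L := fun j => L (j + 1)) h).succ⟩

theorem exists_oddDependence (m : ℕ) (V : Finset C) (a : ℕ) (L : ℕ → Finset C) :
    ∃ Y Λ, OddDependence m V (2 * a + 1) L Y Λ := by
  obtain ⟨Y, Λ, h⟩ := exists_evenDependence m V a fun j => L (j + 1)
  exact ⟨_, _, h.succ⟩

theorem EvenDependence.pathColourable {m n : ℕ} {V Y Λ : Finset C} {L : ℕ → Finset C}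
    (h : EvenDependence m V n L Y Λ) (hL : ∀ j, 2 * m + 1 ≤ (L j).card) {A B : Finset C}
    (hA : A.card ≤ m) (hB : B.card ≤ m) (hBV : B ⊆ V) (hAB : Disjoint A B)
    (hcost : ((A ∩ residue ∅ n L).card : ℤ) + (B ∩ Y).card ≤ excess m ∅ n L) :
    PathColourable m A B n L := by
  refine pathColourable_of_card_inter_residue_le hA hB n hL ?_
  have hABΛ : A ∩ (B ∩ Λ) = ∅ :=
    Finset.disjoint_iff_inter_eq_empty.1 (hAB.mono_right Finset.inter_subset_left)
  rw [h.residue_eq hBV, h.excess_eq hBV, Finset.inter_union_distrib_left, hABΛ, Finset.union_empty]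
  omega

theorem OddDependence.pathColourable {m n : ℕ} {V Y Λ : Finset C} {L : ℕ → Finset C}
    (h : OddDependence m V n L Y Λ) (hL : ∀ j, 2 * m + 1 ≤ (L j).card) {A B : Finset C}
    (hA : A.card ≤ m) (hB : B.card ≤ m) (hBV : B ⊆ V)
    (hcost : ((A ∩ residue ∅ n L).card : ℤ) + (B ∩ Y).card - (A ∩ B ∩ Λ).card ≤ excess m ∅ n L) :
    PathColourable m A B n L := by
  refine pathColourable_of_card_inter_residue_le hA hB n hL ?_
  have hsplit : (A ∩ (residue ∅ n L \ (B ∩ Λ))).card + (A ∩ B ∩ Λ).card =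
      (A ∩ residue ∅ n L).card := by
    have hsub : A ∩ B ∩ Λ ⊆ A ∩ residue ∅ n L := by
      have := h.linked_subset_residue
      grind
    rw [← Finset.card_sdiff_add_card_eq_card hsub]
    congr 2
    grind
  rw [h.residue_eq hBV, h.excess_eq hBV]
  omega

theorem exists_pathColourable_condition_even {m : ℕ} (V : Finset C) (a : ℕ) {L : ℕ → Finset C}
    (hL : ∀ j, 2 * m + 1 ≤ (L j).card) :
    ∃ X Y : Finset C, ∀ A B : Finset C, A.card ≤ m → B.card ≤ m → B ⊆ V → Disjoint A B →
      (A ∩ X).card + (B ∩ Y).card ≤ max X.card Y.card + 1 → PathColourable m A B (2 * a) L := by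
  obtain rfl | ⟨b, rfl⟩ : a = 0 ∨ ∃ b, a = b + 1 := by cases a <;> simp
  · exact ⟨∅, ∅, fun A B _ _ _ hAB _ => pathColourable_zero hAB m L⟩
  · obtain ⟨Y, Λ, h⟩ := exists_evenDependence m V (b + 1) L
    refine ⟨residue ∅ (2 * (b + 1)) L, Y, fun A B hA hB hBV hAB hcost =>
      h.pathColourable hL hA hB hBV hAB ?_⟩
    have hX : ((residue ∅ (2 * (b + 1)) L).card : ℤ) + 1 ≤ excess m ∅ (2 * (b + 1)) L := by
      have := le_excess_odd (m := m) ∅ b (L := fun j => L (j + 1)) fun j => hL _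
      rw [show 2 * (b + 1) = 2 * b + 1 + 1 from rfl, excess]
      simp only [Finset.card_empty] at this
      omega
    have hY : (Y.card : ℤ) + 1 ≤ excess m ∅ (2 * (b + 1)) L := by
      have := le_excess_even V (b + 1) hL
      rw [h.excess_eq subset_rfl, Finset.inter_eq_right.2 h.costly_subset] at this
      omega
    omega

theorem exists_pathColourable_condition_odd {m : ℕ} (V : Finset C) {a : ℕ} (ha : 1 ≤ a)
    {L : ℕ → Finset C} (hL : ∀ j, 2 * m + 1 ≤ (L j).card) :
    ∃ (X Y Λ : Finset C) (t : ℤ), Y ⊆ V ∧ Λ ⊆ V ∧ Λ ⊆ X ∧ (m : ℤ) + 2 ≤ t ∧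
      (X.card : ℤ) + Y.card - Λ.card + 1 - m ≤ t ∧
      ∀ A B : Finset C, A.card ≤ m → B.card ≤ m → B ⊆ V →
        ((A ∩ X).card : ℤ) + (B ∩ Y).card - (A ∩ B ∩ Λ).card ≤ t →
        PathColourable m A B (2 * a + 1) L := by
  obtain ⟨Y, Λ, h⟩ := exists_oddDependence m V a L
  refine ⟨residue ∅ (2 * a + 1) L, Y, Λ, excess m ∅ (2 * a + 1) L, h.costly_subset,
    h.linked_subset, h.linked_subset_residue, ?_, ?_,
    fun A B hA hB hBV => h.pathColourable hL hA hB hBV⟩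
  · have := le_excess_odd (m := m) ∅ a hL
    simp only [Finset.card_empty] at this
    omega
  · have hres := Finset.card_sdiff_add_card_eq_card h.linked_subset_residue
    have hexc : (a : ℤ) + (residue V (2 * a + 1) L).card - m ≤ excess m V (2 * a + 1) L := by
      have := le_excess_even V a (L := fun j => L (j + 1)) fun j => hL _
      rw [excess]
      omega
    rw [h.excess_eq subset_rfl, h.residue_eq subset_rfl, Finset.inter_eq_right.2 h.linked_subset,
      Finset.inter_eq_right.2 h.costly_subset] at hexc
    omega

end Path

section ExtremePoints

theorem exists_mem_extremePoints_le {X : Type*} [AddCommGroup X] [Module ℝ X] [TopologicalSpace X]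
    [T2Space X] [IsTopologicalAddGroup X] [ContinuousSMul ℝ X] [LocallyConvexSpace ℝ X] {K : Set X}
    (hK : IsCompact K) (l : X →L[ℝ] ℝ) {x₀ : X} (hx₀ : x₀ ∈ K) :
    ∃ x ∈ K.extremePoints ℝ, l x₀ ≤ l x := by
  obtain ⟨y, hy, hmax⟩ := hK.exists_isMaxOn ⟨x₀, hx₀⟩ l.continuous.continuousOn
  have hface : IsExposed ℝ K (l.toExposed K) :=
    ContinuousLinearMap.toExposed.isExposed
  obtain ⟨x, hx⟩ := (hface.isCompact hK).extremePoints_nonempty ⟨y, hy, hmax⟩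
  exact ⟨x, hface.isExtreme.extremePoints_subset_extremePoints hx, hx.1.2 x₀ hx₀⟩

theorem eq_zero_of_mem_extremePoints {X : Type*} [AddCommGroup X] [Module ℝ X] {K : Set X} {x g : X}
    (hx : x ∈ K.extremePoints ℝ) (hadd : x + g ∈ K) (hsub : x - g ∈ K) : g = 0 := by
  have hmid : x ∈ openSegment ℝ (x + g) (x - g) :=
    ⟨1 / 2, 1 / 2, by norm_num, by norm_num, by norm_num, by module⟩
  simpa using (mem_extremePoints_iff_left.1 hx).2 _ hadd _ hsub hmid

variable {C κ : Type*}

theorem exists_pos_add_sub_smul_mem_Icc {lo hi x g : C → ℝ} (hx : x ∈ Set.Icc lo hi)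
    (hg : ∀ j, g j ≠ 0 → lo j < x j ∧ x j < hi j) (hfin : (Function.support g).Finite) :
    ∃ ε > (0 : ℝ), x + ε • g ∈ Set.Icc lo hi ∧ x - ε • g ∈ Set.Icc lo hi := by
  have hnear : ∀ j ∈ Function.support g, ∀ᶠ ε in nhdsWithin (0 : ℝ) (Set.Ioi 0),
      x j + ε * g j ∈ Set.Icc (lo j) (hi j) ∧ x j - ε * g j ∈ Set.Icc (lo j) (hi j) := by
    intro j hj
    have hnhds := Icc_mem_nhds (hg j hj).1 (hg j hj).2
    have hadd : ContinuousAt (fun ε : ℝ => x j + ε * g j) 0 := by fun_prop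
    have hsub : ContinuousAt (fun ε : ℝ => x j - ε * g j) 0 := by fun_prop
    exact ((hadd.eventually_mem (by simpa using hnhds)).and
      (hsub.eventually_mem (by simpa using hnhds))).filter_mono nhdsWithin_le_nhds
  obtain ⟨ε, hε, hε0⟩ := (((Filter.eventually_all_finite hfin).2 hnear).and
    self_mem_nhdsWithin).exists
  have hbox : ∀ j, x j + ε * g j ∈ Set.Icc (lo j) (hi j) ∧
      x j - ε * g j ∈ Set.Icc (lo j) (hi j) := by
    intro j
    by_cases hj : g j = 0
    · simpa [hj] using ⟨hx.1 j, hx.2 j⟩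
    · exact hε j hj
  exact ⟨ε, hε0, ⟨fun j => (hbox j).1.1, fun j => (hbox j).1.2⟩,
    ⟨fun j => (hbox j).2.1, fun j => (hbox j).2.2⟩⟩

/-- The feasible set of a linear program: the points of a box at which each row `R r` takes a value
in the prescribed set `J r`. -/
def boxSection (lo hi : C → ℝ) (R : κ → (C → ℝ) →L[ℝ] ℝ) (J : κ → Set ℝ) : Set (C → ℝ) :=
  Set.Icc lo hi ∩ ⋂ r, R r ⁻¹' J r

variable {lo hi x : C → ℝ} {R : κ → (C → ℝ) →L[ℝ] ℝ} {J : κ → Set ℝ}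

theorem mem_boxSection : x ∈ boxSection lo hi R J ↔ x ∈ Set.Icc lo hi ∧ ∀ r, R r x ∈ J r := by
  simp [boxSection]

theorem isCompact_boxSection (lo hi : C → ℝ) (R : κ → (C → ℝ) →L[ℝ] ℝ) (hJ : ∀ r, IsClosed (J r)) :
    IsCompact (boxSection lo hi R J) :=
  isCompact_Icc.inter_right (isClosed_iInter fun r => (hJ r).preimage (R r).continuous)

theorem eq_zero_of_mem_extremePoints_boxSection
    (hx : x ∈ (boxSection lo hi R J).extremePoints ℝ) {g : C → ℝ}
    (hg : ∀ j, g j ≠ 0 → lo j < x j ∧ x j < hi j) (hfin : (Function.support g).Finite)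
    (hR : ∀ r, R r g = 0) : g = 0 := by
  obtain ⟨hbox, hrow⟩ := mem_boxSection.1 hx.1
  obtain ⟨ε, hε, hadd, hsub⟩ := exists_pos_add_sub_smul_mem_Icc hbox hg hfin
  have hzero : ε • g = 0 := eq_zero_of_mem_extremePoints hx
    (mem_boxSection.2 ⟨hadd, fun r => by simpa [hR] using hrow r⟩)
    (mem_boxSection.2 ⟨hsub, fun r => by simpa [hR] using hrow r⟩)
  exact (smul_eq_zero.1 hzero).resolve_left hε.ne'

theorem card_le_of_forall_eq_zero [Fintype κ] (R : κ → (C → ℝ) →ₗ[ℝ] ℝ) (F : Finset C)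
    (h : ∀ g : C → ℝ, (∀ j ∉ F, g j = 0) → (∀ r, R r g = 0) → g = 0) :
    F.card ≤ Fintype.card κ := by
  let T : (F → ℝ) →ₗ[ℝ] (κ → ℝ) :=
    LinearMap.pi R ∘ₗ Function.ExtendByZero.linearMap ℝ (Subtype.val : F → C)
  have hT : Function.Injective T := by
    rw [← LinearMap.ker_eq_bot, LinearMap.ker_eq_bot']
    intro g hg
    have hzero : Function.extend Subtype.val g 0 = 0 :=
      h _ (fun j hj => Function.extend_apply' _ _ j fun ⟨i, hij⟩ => hj (hij ▸ i.2)) (congrFun hg)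
    ext i
    rw [← Subtype.val_injective.extend_apply g (0 : C → ℝ) i, hzero]
    rfl
  simpa using LinearMap.finrank_le_finrank_of_injective hT

theorem card_le_of_mem_extremePoints_boxSection_of_redundant {κ' : Type*} [Fintype κ'] (f : κ' → κ)
    (hx : x ∈ (boxSection lo hi R J).extremePoints ℝ) {F : Finset C}
    (hF : ∀ j ∈ F, lo j < x j ∧ x j < hi j)
    (hf : ∀ g : C → ℝ, (∀ j ∉ F, g j = 0) → (∀ s, R (f s) g = 0) → ∀ r, R r g = 0) :
    F.card ≤ Fintype.card κ' := by
  refine card_le_of_forall_eq_zero (fun s => (R (f s) : (C → ℝ) →ₗ[ℝ] ℝ)) F fun g hgF hgR => ?_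
  have hsupp : Function.support g ⊆ F := fun j hj => by_contra fun hjF => hj (hgF j hjF)
  exact eq_zero_of_mem_extremePoints_boxSection hx (fun j hj => hF j (hsupp hj))
    (F.finite_toSet.subset hsupp) (hf g hgF hgR)

theorem card_le_of_mem_extremePoints_boxSection [Fintype κ]
    (hx : x ∈ (boxSection lo hi R J).extremePoints ℝ) {F : Finset C}
    (hF : ∀ j ∈ F, lo j < x j ∧ x j < hi j) : F.card ≤ Fintype.card κ :=
  card_le_of_mem_extremePoints_boxSection_of_redundant id hx hF fun _ _ h => h

/-- The linear functional `x ↦ ∑ j ∈ E, w j * x j`, which serves as a row of a linear program. -/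
def weightedSum (w : C → ℝ) (E : Finset C) : (C → ℝ) →L[ℝ] ℝ :=
  ∑ j ∈ E, w j • ContinuousLinearMap.proj j

@[simp]
theorem weightedSum_apply (w : C → ℝ) (E : Finset C) (x : C → ℝ) :
    weightedSum w E x = ∑ j ∈ E, w j * x j := by
  simp [weightedSum]

end ExtremePoints

section Balancing

variable {C : Type*}

theorem exists_subset_card_mul_sum_le (F : Finset C) (x : C → ℝ) {k : ℕ} (hk : k ≤ F.card) :
    ∃ T ⊆ F, T.card = k ∧ k * ∑ j ∈ F, x j ≤ F.card * ∑ j ∈ T, x j := by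
  classical
  induction hn : F.card - k generalizing F with
  | zero =>
    obtain rfl : F.card = k := by omega
    exact ⟨F, subset_rfl, rfl, le_rfl⟩
  | succ n ih =>
    obtain ⟨a, ha, hmin⟩ := F.exists_min_image x (Finset.card_pos.1 (by omega))
    have hcard := Finset.card_erase_add_one ha
    obtain ⟨T, hT, hTk, hmean⟩ := ih (F.erase a) (by omega) (by omega)
    refine ⟨T, hT.trans (F.erase_subset a), hTk, ?_⟩
    have hsum := Finset.add_sum_erase F x ha
    have hmin' : (F.erase a).card * x a ≤ ∑ j ∈ F.erase a, x j := by
      simpa using Finset.card_nsmul_le_sum _ x (x a) fun j hj => hmin j (Finset.mem_of_mem_erase hj)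
    obtain h0 | hpos := Nat.eq_zero_or_pos (F.erase a).card
    · obtain rfl : k = 0 := by omega
      simp [Finset.card_eq_zero.1 hTk]
    · rw [← hcard, ← hsum]
      push_cast
      have hpos' : (0 : ℝ) < (F.erase a).card := by exact_mod_cast hpos
      refine le_of_mul_le_mul_left ?_ hpos'
      have hk0 : (0 : ℝ) ≤ k := k.cast_nonneg
      calc _ = k * ((F.erase a).card * x a + (F.erase a).card * ∑ j ∈ F.erase a, x j) := by ring
        _ ≤ k * (∑ j ∈ F.erase a, x j + (F.erase a).card * ∑ j ∈ F.erase a, x j) := by gcongr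
        _ = ((F.erase a).card + 1) * (k * ∑ j ∈ F.erase a, x j) := by ring
        _ ≤ ((F.erase a).card + 1) * ((F.erase a).card * ∑ j ∈ T, x j) := by gcongr
        _ = _ := by ring

/-- The elements of `E` at which `x`, a point of the unit cube, is not integral. -/
noncomputable def fractionalSupport (E : Finset C) (x : C → ℝ) : Finset C :=
  E.filter fun j => 0 < x j ∧ x j < 1

theorem eq_zero_or_eq_one_of_notMem_fractionalSupport {E : Finset C} {x : C → ℝ} {j : C}
    (hx : x j ∈ Set.Icc 0 1) (hj : j ∈ E) (hjF : j ∉ fractionalSupport E x) :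
    x j = 0 ∨ x j = 1 := by
  obtain ⟨h0, h1⟩ := hx
  simp only [fractionalSupport, Finset.mem_filter, hj, true_and] at hjF
  grind

theorem exists_balanced_point {ι : Type*} [Fintype ι] (E : Finset C) (α β : ι → C → ℝ) :
    ∃ x : C → ℝ, (∀ j, x j ∈ Set.Icc 0 1) ∧ ∑ j ∈ E, x j = (E.card : ℝ) / 2 ∧
      (∀ i, ∑ j ∈ E, (α i j * x j + β i j * (1 - x j)) ≤
        max (∑ j ∈ E, α i j) (∑ j ∈ E, β i j)) ∧
      (fractionalSupport E x).card ≤ Fintype.card ι + 1 := by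
  let R : Option ι → (C → ℝ) →L[ℝ] ℝ
    | none => weightedSum 1 E
    | some i => weightedSum (fun j => α i j - β i j) E
  let J : Option ι → Set ℝ
    | none => {(E.card : ℝ) / 2}
    | some i => Set.Iic (max (∑ j ∈ E, α i j) (∑ j ∈ E, β i j) - ∑ j ∈ E, β i j)
  have hJ : ∀ r, IsClosed (J r) := by
    rintro (_ | i)
    exacts [isClosed_singleton, isClosed_Iic]
  have hstart : (fun _ => 1 / 2 : C → ℝ) ∈ boxSection 0 1 R J := by
    refine mem_boxSection.2 ⟨⟨fun j => by norm_num, fun j => by norm_num⟩, ?_⟩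
    rintro (_ | i)
    · simp [R, J, div_eq_mul_inv]
    · have hleft := le_max_left (∑ j ∈ E, α i j) (∑ j ∈ E, β i j)
      have hright := le_max_right (∑ j ∈ E, α i j) (∑ j ∈ E, β i j)
      simp only [R, J, weightedSum_apply, ← Finset.sum_mul, Finset.sum_sub_distrib, Set.mem_Iic]
      linarith
  obtain ⟨x, hext⟩ := (isCompact_boxSection 0 1 R hJ).extremePoints_nonempty ⟨_, hstart⟩
  obtain ⟨hbox, hrow⟩ := mem_boxSection.1 hext.1
  refine ⟨x, fun j => ⟨hbox.1 j, hbox.2 j⟩, by simpa [R, J] using hrow none, fun i => ?_, ?_⟩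
  · have hi : weightedSum (fun j => α i j - β i j) E x ≤ _ := hrow (some i)
    rw [weightedSum_apply, le_sub_iff_add_le, ← Finset.sum_add_distrib] at hi
    exact (Finset.sum_congr rfl fun j _ => by ring).trans_le hi
  · rw [← Fintype.card_option]
    exact card_le_of_mem_extremePoints_boxSection hext fun j hj => (Finset.mem_filter.1 hj).2

theorem exists_nested_rounding_of_sum_eq [DecidableEq C] {F : Finset C} {x : C → ℝ}
    (hx : ∀ j ∈ F, x j ≤ 1) {k : ℕ} (hsum : ∑ j ∈ F, x j = k + 1 / 2) :
    ∃ S T : Finset C, S ⊆ T ∧ T ⊆ F ∧ S.card = k ∧ T.card = k + 1 ∧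
      ∑ j ∈ S, (1 - x j) + ∑ j ∈ F \ T, x j ≤ ((F.card : ℝ) - 1) / 2 := by
  have hk : k + 1 ≤ F.card := by
    have : ∑ j ∈ F, x j ≤ F.card := by simpa using Finset.sum_le_card_nsmul F x 1 hx
    have : (k : ℝ) < F.card := by linarith
    exact_mod_cast this
  obtain ⟨T, hTF, hTcard, hT⟩ := exists_subset_card_mul_sum_le F x hk
  obtain ⟨S, hST, hScard, hS⟩ := exists_subset_card_mul_sum_le T x (k := k) (by omega)
  refine ⟨S, T, hST, hTF, hScard, hTcard, ?_⟩
  have hdiff := Finset.sum_sdiff (f := x) hTF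
  have hn : (0 : ℝ) < F.card := by exact_mod_cast (by omega : 0 < F.card)
  rw [hsum] at hT hdiff
  rw [hTcard] at hS
  push_cast at hT hS
  have hsums : (2 * k + 1) ^ 2 ≤ 2 * F.card * (∑ j ∈ S, x j + ∑ j ∈ T, x j) := by
    have hk1 : (0 : ℝ) < k + 1 := by positivity
    refine le_of_mul_le_mul_left ?_ hk1
    nlinarith
  have hgoal : 2 * F.card * (2 * k + 1 / 2 - (∑ j ∈ S, x j + ∑ j ∈ T, x j)) ≤
      2 * F.card * (((F.card : ℝ) - 1) / 2) := by
    nlinarith [sq_nonneg ((F.card : ℝ) - (2 * k + 1))]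
  have := le_of_mul_le_mul_left hgoal (by positivity)
  simp only [Finset.sum_sub_distrib, Finset.sum_const, hScard, nsmul_eq_mul, mul_one]
  linarith

theorem exists_nested_rounding [DecidableEq C] {E : Finset C} {x : C → ℝ}
    (hx : ∀ j ∈ E, x j ∈ Set.Icc 0 1) {p : ℕ} (hsum : ∑ j ∈ E, x j = p + 1 / 2) :
    ∃ S T : Finset C, S ⊆ T ∧ T ⊆ E ∧ S.card = p ∧ T.card = p + 1 ∧
      ∑ j ∈ S, (1 - x j) + ∑ j ∈ E \ T, x j ≤ (((fractionalSupport E x).card : ℝ) - 1) / 2 := by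
  set F := fractionalSupport E x
  set N := E.filter fun j => x j = 1
  have hF : ∀ j ∈ F, 0 < x j ∧ x j < 1 := fun j hj => (Finset.mem_filter.1 hj).2
  have hN : ∀ j ∈ N, x j = 1 := fun j hj => (Finset.mem_filter.1 hj).2
  have hNF : Disjoint N F :=
    Finset.disjoint_left.2 fun j hjN hjF => (hF j hjF).2.ne (hN j hjN)
  have hNFE : N ∪ F ⊆ E := Finset.union_subset (Finset.filter_subset _ _) (Finset.filter_subset _ _)
  have hzero : ∀ j ∈ E, j ∉ N ∪ F → x j = 0 := by
    intro j hj hjNF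
    have := eq_zero_or_eq_one_of_notMem_fractionalSupport (hx j hj) hj
    grind
  have hsumN : ∑ j ∈ N, x j = N.card := by simp [Finset.sum_congr rfl hN]
  have hsumF : N.card + ∑ j ∈ F, x j = p + 1 / 2 := by
    rw [← hsum, ← hsumN, ← Finset.sum_union hNF]
    exact Finset.sum_subset hNFE hzero
  obtain ⟨k, rfl⟩ : ∃ k, p = N.card + k := by
    refine Nat.exists_eq_add_of_le (Nat.lt_succ_iff.1 ?_)
    have := Finset.sum_nonneg fun j hj => (hF j hj).1.le
    have : (N.card : ℝ) < p + 1 := by linarith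
    exact_mod_cast this
  obtain ⟨S, T, hST, hTF, hScard, hTcard, hbound⟩ :=
    exists_nested_rounding_of_sum_eq (F := F) (k := k) (fun j hj => (hF j hj).2.le)
      (by push_cast at hsumF; linarith)
  have hNT : Disjoint N T := hNF.mono_right hTF
  have hNS : Disjoint N S := hNT.mono_right hST
  refine ⟨N ∪ S, N ∪ T, Finset.union_subset_union_right hST,
    (Finset.union_subset_union_right hTF).trans hNFE,
    by rw [Finset.card_union_of_disjoint hNS, hScard],
    by rw [Finset.card_union_of_disjoint hNT, hTcard, add_assoc], le_of_eq_of_le ?_ hbound⟩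
  have hrest : ∑ j ∈ E \ (N ∪ T), x j = ∑ j ∈ F \ T, x j := by
    refine (Finset.sum_subset (fun j hj => ?_) fun j hj hjF => ?_).symm
    · have := Finset.disjoint_right.1 hNF (Finset.mem_sdiff.1 hj).1
      have := hNFE (Finset.mem_union_right N (Finset.mem_sdiff.1 hj).1)
      grind
    · exact hzero j (by grind) (by grind)
  have hone : ∑ j ∈ N, (1 - x j) = 0 := Finset.sum_eq_zero fun j hj => by rw [hN j hj, sub_self]
  rw [Finset.sum_union hNS, hrest, hone, zero_add]

theorem sum_add_sum_sdiff_le [DecidableEq C] {S T E : Finset C} (hST : S ⊆ T) (hTE : T ⊆ E)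
    {α β x : C → ℝ} (hα : ∀ j, α j ∈ Set.Icc 0 1) (hβ : ∀ j, β j ∈ Set.Icc 0 1)
    (hx : ∀ j, x j ∈ Set.Icc 0 1) :
    ∑ j ∈ S, α j + ∑ j ∈ E \ T, β j ≤
      ∑ j ∈ E, (α j * x j + β j * (1 - x j)) + (∑ j ∈ S, (1 - x j) + ∑ j ∈ E \ T, x j) := by
  have hconvex : ∀ j, 0 ≤ α j * x j ∧ 0 ≤ β j * (1 - x j) := fun j =>
    ⟨mul_nonneg (hα j).1 (hx j).1, mul_nonneg (hβ j).1 (sub_nonneg.2 (hx j).2)⟩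
  have hS : ∑ j ∈ S, α j ≤ ∑ j ∈ S, (α j * x j + β j * (1 - x j)) + ∑ j ∈ S, (1 - x j) := by
    rw [← Finset.sum_add_distrib]
    refine Finset.sum_le_sum fun j _ => ?_
    linarith [(hconvex j).2, mul_nonneg (sub_nonneg.2 (hα j).2) (sub_nonneg.2 (hx j).2)]
  have hT : ∑ j ∈ E \ T, β j ≤
      ∑ j ∈ E \ T, (α j * x j + β j * (1 - x j)) + ∑ j ∈ E \ T, x j := by
    rw [← Finset.sum_add_distrib]
    refine Finset.sum_le_sum fun j _ => ?_
    linarith [(hconvex j).1, mul_nonneg (sub_nonneg.2 (hβ j).2) (hx j).1]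
  have hE : ∑ j ∈ S, (α j * x j + β j * (1 - x j)) + ∑ j ∈ E \ T, (α j * x j + β j * (1 - x j)) ≤
      ∑ j ∈ E, (α j * x j + β j * (1 - x j)) := by
    rw [← Finset.sum_union (Finset.disjoint_sdiff.mono_left hST)]
    exact Finset.sum_le_sum_of_subset_of_nonneg
      (Finset.union_subset (hST.trans hTE) Finset.sdiff_subset)
      fun j _ _ => add_nonneg (hconvex j).1 (hconvex j).2
  linarith

theorem exists_balanced_halves {ι : Type*} [Fintype ι] {E : Finset C} {m : ℕ}
    (hE : E.card = 2 * m + 1) {α β : ι → C → ℝ} (hα : ∀ i j, α i j ∈ Set.Icc 0 1)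
    (hβ : ∀ i j, β i j ∈ Set.Icc 0 1) :
    ∃ S T : Finset C, S ⊆ E ∧ T ⊆ E ∧ Disjoint S T ∧ S.card = m ∧ T.card = m ∧ ∀ i,
      ∑ j ∈ S, α i j + ∑ j ∈ T, β i j ≤
        max (∑ j ∈ E, α i j) (∑ j ∈ E, β i j) + (Fintype.card ι : ℝ) / 2 := by
  classical
  obtain ⟨x, hx, hsum, hmax, hfrac⟩ := exists_balanced_point E α β
  have hsum' : ∑ j ∈ E, x j = m + 1 / 2 := by
    rw [hsum, hE]
    push_cast
    ring
  obtain ⟨S, T, hST, hTE, hScard, hTcard, hround⟩ := exists_nested_rounding (fun j _ => hx j) hsum'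
  have hcompl : (E \ T).card = m := by
    rw [Finset.card_sdiff_of_subset hTE]
    omega
  refine ⟨S, E \ T, hST.trans hTE, Finset.sdiff_subset, Finset.disjoint_sdiff.mono_left hST,
    hScard, hcompl, fun i => ?_⟩
  have hfrac' : ((fractionalSupport E x).card : ℝ) ≤ Fintype.card ι + 1 := by exact_mod_cast hfrac
  linarith [sum_add_sum_sdiff_le hST hTE (hα i) (hβ i) hx, hmax i]

theorem exists_injOn_eq_self_of_mem {U V : Finset C} (h : U.card = V.card) :
    ∃ g : C → C, Set.InjOn g U ∧ Set.MapsTo g U V ∧ ∀ c ∈ U, g c ∈ U → g c = c := by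
  classical
  obtain ⟨e, he⟩ := Finset.exists_equiv_extend_of_card_eq (s := {c : U | (c : C) ∈ V})
    (f := Subtype.val) (by simpa using h) (by grind) Subtype.val_injective.injOn
  refine ⟨fun c => if hc : c ∈ U then e ⟨c, hc⟩ else c, fun c hc d hd hcd => ?_, fun c hc => ?_,
    fun c hc hgc => ?_⟩
  · rw [Finset.mem_coe] at hc hd
    simpa [hc, hd, Subtype.ext_iff] using hcd
  · rw [Finset.mem_coe] at hc
    simp [hc]
  · simp only [hc, ↓reduceDIte] at hgc ⊢
    have hfix := he ⟨e ⟨c, hc⟩, hgc⟩ (by simp)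
    simpa [Subtype.ext_iff] using hfix

theorem exists_disjoint_branch_colours [DecidableEq C] {ι : Type*} [Fintype ι]
    (hι : Fintype.card ι ≤ 3) {m : ℕ} {U V : Finset C} (hU : U.card = 2 * m + 1)
    (hV : V.card = 2 * m + 1) (X Y : ι → Finset C) :
    ∃ A B : Finset C, A ⊆ U ∧ B ⊆ V ∧ A.card = m ∧ B.card = m ∧ Disjoint A B ∧
      ∀ i, (A ∩ X i).card + (B ∩ Y i).card ≤ max (X i).card (Y i).card + 1 := by
  obtain ⟨g, hinj, hmaps, hfix⟩ := exists_injOn_eq_self_of_mem (hU.trans hV.symm)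
  obtain ⟨S, T, hS, hT, hST, hScard, hTcard, hbound⟩ := exists_balanced_halves hU
    (α := fun i c => if c ∈ X i then 1 else 0) (β := fun i c => if g c ∈ Y i then 1 else 0)
    (fun i c => by split_ifs <;> simp) (fun i c => by split_ifs <;> simp)
  have hinjT : Set.InjOn g T := hinj.mono hT
  refine ⟨S, T.image g, hS, Finset.image_subset_iff.2 fun c hc => hmaps (hT hc), hScard,
    by rw [Finset.card_image_of_injOn hinjT, hTcard], ?_, fun i => ?_⟩
  · rw [Finset.disjoint_left]
    intro c hcS hcT
    obtain ⟨d, hd, rfl⟩ := Finset.mem_image.1 hcT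
    exact Finset.disjoint_left.1 hST hcS ((hfix d (hT hd) (hS hcS)).symm ▸ hd)
  · have himage : ∀ {W : Finset C}, W ⊆ U →
        (W.filter fun c => g c ∈ Y i).card = (W.image g ∩ Y i).card := by
      intro W hW
      rw [← Finset.card_image_of_injOn (hinj.mono ((Finset.filter_subset _ W).trans hW))]
      congr 1
      grind
    have hi := hbound i
    simp only [Finset.sum_boole, Finset.filter_mem_eq_inter, himage hT, himage subset_rfl] at hi
    have hX : (U ∩ X i).card ≤ (X i).card := Finset.card_le_card Finset.inter_subset_right
    have hY : (U.image g ∩ Y i).card ≤ (Y i).card := Finset.card_le_card Finset.inter_subset_right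
    have hι' : (Fintype.card ι : ℝ) ≤ 3 := by exact_mod_cast hι
    have hlt : ((S ∩ X i).card + (T.image g ∩ Y i).card : ℝ) <
        (max (U ∩ X i).card (U.image g ∩ Y i).card : ℕ) + 2 := by
      push_cast
      linarith
    have : (S ∩ X i).card + (T.image g ∩ Y i).card <
        max (U ∩ X i).card (U.image g ∩ Y i).card + 2 := by exact_mod_cast hlt
    omega

end Balancing

section Rounding

variable {C : Type*}

theorem exists_ne_notMem_range_intCast {U : Finset C} {y : C → ℝ} {p : ℤ} (hsum : ∑ j ∈ U, y j = p)
    {a : C} (ha : a ∈ U) (hya : y a ∉ (Int.castAddHom ℝ).range) :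
    ∃ b ∈ U, b ≠ a ∧ y b ∉ (Int.castAddHom ℝ).range := by
  classical
  by_contra! h
  have hrest : ∑ j ∈ U.erase a, y j ∈ (Int.castAddHom ℝ).range :=
    sum_mem fun j hj => h j (Finset.mem_of_mem_erase hj) (Finset.ne_of_mem_erase hj)
  have hya' : y a = p - ∑ j ∈ U.erase a, y j := by
    rw [← hsum, ← Finset.add_sum_erase U y ha, add_sub_cancel_right]
  exact hya (hya' ▸ sub_mem ⟨p, rfl⟩ hrest)

/-- The points of the box between the integral vectors `lo` and `hi` whose sum over each set `W r`
is `p r`. -/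
def boxWithSums {κ : Type*} (lo hi : C → ℤ) (W : κ → Finset C) (p : κ → ℤ) : Set (C → ℝ) :=
  boxSection (fun j => lo j) (fun j => hi j) (fun r => weightedSum 1 (W r)) fun r => {(p r : ℝ)}

section

variable {κ : Type*} {lo hi : C → ℤ} {W : κ → Finset C} {p : κ → ℤ} {y : C → ℝ}

theorem mem_boxWithSums : y ∈ boxWithSums lo hi W p ↔
    (∀ j, lo j ≤ y j ∧ y j ≤ hi j) ∧ ∀ r, ∑ j ∈ W r, y j = p r := by
  simp [boxWithSums, mem_boxSection, Pi.le_def, forall_and]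

theorem lt_and_lt_of_notMem_range_intCast (hy : y ∈ boxWithSums lo hi W p) {j : C}
    (hj : y j ∉ (Int.castAddHom ℝ).range) : lo j < y j ∧ y j < hi j := by
  obtain ⟨hlo, hhi⟩ := (mem_boxWithSums.1 hy).1 j
  exact ⟨hlo.lt_of_ne fun h => hj ⟨lo j, h⟩, hhi.lt_of_ne fun h => hj ⟨hi j, h.symm⟩⟩

theorem exists_mem_of_notMem_range_intCast
    (hy : y ∈ (boxWithSums lo hi W p).extremePoints ℝ) {a : C}
    (ha : y a ∉ (Int.castAddHom ℝ).range) : ∃ r, a ∈ W r := by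
  classical
  by_contra! h
  have hzero : Pi.single a 1 = (0 : C → ℝ) := by
    refine eq_zero_of_mem_extremePoints_boxSection hy (fun j hj => ?_)
      ((Set.finite_singleton a).subset Pi.support_single_subset) fun r => by simp [h r]
    obtain rfl : j = a := by
      by_contra hja
      simp [hja] at hj
    exact lt_and_lt_of_notMem_range_intCast hy.1 ha
  simpa using congrFun hzero a

theorem exists_not_mem_iff_mem_of_notMem_range_intCast
    (hy : y ∈ (boxWithSums lo hi W p).extremePoints ℝ) {a b : C} (hab : a ≠ b)
    (ha : y a ∉ (Int.castAddHom ℝ).range) (hb : y b ∉ (Int.castAddHom ℝ).range) :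
    ∃ r, ¬(a ∈ W r ↔ b ∈ W r) := by
  classical
  by_contra! h
  have hzero : Pi.single a 1 - Pi.single b 1 = (0 : C → ℝ) := by
    refine eq_zero_of_mem_extremePoints_boxSection hy (fun j hj => ?_)
      (((Set.finite_singleton a).union (Set.finite_singleton b)).subset
        ((Function.support_sub _ _).trans
          (Set.union_subset_union Pi.support_single_subset Pi.support_single_subset)))
      fun r => by simp [h r]
    obtain rfl | rfl : j = a ∨ j = b := by
      by_contra hj'
      simp_all
    exacts [lt_and_lt_of_notMem_range_intCast hy.1 ha, lt_and_lt_of_notMem_range_intCast hy.1 hb]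
  simpa [hab] using congrFun hzero a

theorem mem_range_intCast_of_mem_extremePoints [Fintype κ] (hκ : Fintype.card κ ≤ 2)
    (hy : y ∈ (boxWithSums lo hi W p).extremePoints ℝ) (a : C) :
    y a ∈ (Int.castAddHom ℝ).range := by
  classical
  have hrow := (mem_boxWithSums.1 hy.1).2
  by_contra ha
  obtain ⟨r, har⟩ := exists_mem_of_notMem_range_intCast hy ha
  obtain ⟨b, hbr, hba, hb⟩ := exists_ne_notMem_range_intCast (hrow r) har ha
  obtain ⟨s, hs⟩ := exists_not_mem_iff_mem_of_notMem_range_intCast hy hba.symm ha hb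
  obtain ⟨c, hc, hca, hcb⟩ : ∃ c, y c ∉ (Int.castAddHom ℝ).range ∧ c ≠ a ∧ c ≠ b := by
    by_cases has : a ∈ W s
    · obtain ⟨c, hcs, hca, hc⟩ := exists_ne_notMem_range_intCast (hrow s) has ha
      exact ⟨c, hc, hca, by grind⟩
    · obtain ⟨c, hcs, hcb, hc⟩ := exists_ne_notMem_range_intCast (hrow s) (by tauto : b ∈ W s) hb
      exact ⟨c, hc, by grind, hcb⟩
  have hthree : ({a, b, c} : Finset C).card = 3 :=
    Finset.card_eq_three.2 ⟨a, b, c, hba.symm, hca.symm, hcb.symm, rfl⟩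
  have hle : ({a, b, c} : Finset C).card ≤ Fintype.card κ := by
    refine card_le_of_mem_extremePoints_boxSection hy fun j hj => ?_
    refine lt_and_lt_of_notMem_range_intCast hy.1 ?_
    obtain rfl | rfl | rfl : j = a ∨ j = b ∨ j = c := by simpa using hj
    all_goals assumption
  omega

theorem isCompact_boxWithSums (lo hi : C → ℤ) (W : κ → Finset C) (p : κ → ℤ) :
    IsCompact (boxWithSums lo hi W p) :=
  isCompact_boxSection _ _ _ fun _ => isClosed_singleton

theorem exists_integral_rounding_ge [Fintype κ] (hκ : Fintype.card κ ≤ 2) {x : C → ℝ}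
    (hx : ∀ r, ∑ j ∈ W r, x j = p r) (l : (C → ℝ) →L[ℝ] ℝ) :
    ∃ y : C → ℤ, (∀ j, ⌊x j⌋ ≤ y j ∧ y j ≤ ⌈x j⌉) ∧ (∀ r, ∑ j ∈ W r, y j = p r) ∧
      l x ≤ l fun j => y j := by
  obtain ⟨z, hz, hl⟩ := exists_mem_extremePoints_le
    (isCompact_boxWithSums (fun j => ⌊x j⌋) (fun j => ⌈x j⌉) W p) l
    (mem_boxWithSums.2 ⟨fun j => ⟨Int.floor_le _, Int.le_ceil _⟩, hx⟩)
  choose y hy using mem_range_intCast_of_mem_extremePoints hκ hz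
  obtain rfl : (fun j => (y j : ℝ)) = z := funext hy
  obtain ⟨hbox, hrow⟩ := mem_boxWithSums.1 hz.1
  exact ⟨y, by exact_mod_cast hbox, by exact_mod_cast hrow, hl⟩

end

theorem eq_zero_or_eq_one_of_floor_le_of_le_ceil {a : ℝ} (ha : a ∈ Set.Icc 0 1) {n : ℤ}
    (hn : ⌊a⌋ ≤ n ∧ n ≤ ⌈a⌉) : n = 0 ∨ n = 1 := by
  have h0 : 0 ≤ n := (Int.floor_nonneg.2 ha.1).trans hn.1
  have h1 : n ≤ 1 := hn.2.trans (Int.ceil_le.2 (by exact_mod_cast ha.2))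
  omega

variable [DecidableEq C]

theorem exists_close_rounding {U V : Finset C} {x : C → ℝ} (hx : ∀ j, x j ∈ Set.Icc 0 1) {p q : ℕ}
    (hU : ∑ j ∈ U, x j = p) (hV : ∑ j ∈ V, x j = q) (ε : ℝ) :
    ∃ y : C → ℤ, (∀ j, ⌊x j⌋ ≤ y j ∧ y j ≤ ⌈x j⌉) ∧ ∑ j ∈ U, y j = p ∧ ∑ j ∈ V, y j = q ∧
      ∑ j ∈ U ∪ V, (y j - x j) ^ 2 ≤
        ∑ j ∈ U ∪ V, x j * (1 - x j) + ε * ∑ j ∈ U ∩ V, (y j - x j) := by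
  -- On `0/1`-vectors `y`, the squared distance to `x` is an affine function of `y`.
  let l : (C → ℝ) →L[ℝ] ℝ :=
    weightedSum (fun j => 2 * x j - 1) (U ∪ V) + weightedSum (fun _ => ε) (U ∩ V)
  obtain ⟨y, hy, hrow, hl⟩ := exists_integral_rounding_ge (κ := Fin 2) (by simp) (W := ![U, V])
    (p := ![(p : ℤ), q]) (x := x) (by simp [Fin.forall_fin_two, hU, hV]) l
  simp only [Fin.forall_fin_two, Matrix.cons_val_zero, Matrix.cons_val_one] at hrow
  refine ⟨y, hy, hrow.1, hrow.2, ?_⟩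
  have hsq : ∀ j, ((y j : ℝ)) ^ 2 = y j := fun j => by
    obtain h | h := eq_zero_or_eq_one_of_floor_le_of_le_ceil (hx j) (hy j) <;> simp [h]
  have hexpand : ∑ j ∈ U ∪ V, ((y j : ℝ) - x j) ^ 2 = ∑ j ∈ U ∪ V, x j * (1 - x j) -
      (∑ j ∈ U ∪ V, (2 * x j - 1) * y j - ∑ j ∈ U ∪ V, (2 * x j - 1) * x j) := by
    rw [← Finset.sum_sub_distrib, ← Finset.sum_sub_distrib]
    exact Finset.sum_congr rfl fun j _ => by linear_combination hsq j
  simp only [l, add_apply, weightedSum_apply, ← Finset.mul_sum] at hl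
  rw [hexpand, Finset.sum_sub_distrib]
  linarith

end Rounding

section CommonTrace

variable {C : Type w}

theorem sum_mul_one_sub_le {E : Finset C} {x : C → ℝ} (hx : ∀ j, x j ∈ Set.Icc 0 1) :
    ∑ j ∈ E, x j * (1 - x j) ≤ (fractionalSupport E x).card / 4 := by
  have hpoint : ∀ j ∈ E, x j * (1 - x j) ≤ if 0 < x j ∧ x j < 1 then 1 / 4 else 0 := by
    intro j hj
    split_ifs with h
    · nlinarith [sq_nonneg (x j - 1 / 2)]
    · have hjF : j ∉ fractionalSupport E x := fun hjF => h (Finset.mem_filter.1 hjF).2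
      obtain h | h := eq_zero_or_eq_one_of_notMem_fractionalSupport (hx j) hj hjF <;> simp [h]
  refine (Finset.sum_le_sum hpoint).trans_eq ?_
  rw [← Finset.sum_filter, Finset.sum_const, nsmul_eq_mul, fractionalSupport]
  ring

theorem eq_of_floor_le_of_le_ceil {E : Finset C} {x : C → ℝ} (hx : ∀ j, x j ∈ Set.Icc 0 1)
    {y : C → ℤ} (hy : ∀ j, ⌊x j⌋ ≤ y j ∧ y j ≤ ⌈x j⌉) {j : C} (hj : j ∈ E)
    (hjF : j ∉ fractionalSupport E x) : (y j : ℝ) = x j := by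
  obtain h | h := eq_zero_or_eq_one_of_notMem_fractionalSupport (hx j) hj hjF
  all_goals
    have hyj := hy j
    simp only [h, Int.floor_zero, Int.ceil_zero, Int.floor_one, Int.ceil_one] at hyj
    simp [h, le_antisymm hyj.2 hyj.1]

variable [DecidableEq C]

/-- An error vector `e` on `F` of the kind left by rounding a vertex of a linear program with four
weight constraints: its sums over `U` and `V` vanish, and it is small in the Euclidean norm. -/
structure IsSmallError (U V F : Finset C) (e : C → ℝ) : Prop where
  subset_union : F ⊆ U ∪ V
  le_one : ∀ j ∈ F, e j ≤ 1
  sum_inter_left : ∑ j ∈ F ∩ U, e j = 0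
  sum_inter_right : ∑ j ∈ F ∩ V, e j = 0
  card_le : F.card ≤ 6
  card_inter_le : (F ∩ (U ∩ V)).card ≤ 5
  sum_sq_le : ∑ j ∈ F, e j ^ 2 ≤ 3 / 2 + 1 / 30 * ∑ j ∈ F ∩ (U ∩ V), e j

/-- The number of the two sets `U` and `V` that contain `j`. -/
def coverMultiplicity (U V : Finset C) (j : C) : ℝ :=
  (if j ∈ U then 1 else 0) + if j ∈ V then 1 else 0

namespace IsSmallError

variable {U V F : Finset C} {e : C → ℝ}

theorem sum_eq_neg (he : IsSmallError U V F e) : ∑ j ∈ F, e j = -∑ j ∈ F ∩ (U ∩ V), e j := by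
  have hsum := Finset.sum_union_inter (s₁ := F ∩ U) (s₂ := F ∩ V) (f := e)
  rw [← Finset.inter_union_distrib_left, Finset.inter_eq_left.2 he.subset_union,
    ← Finset.inter_inter_distrib_left, he.sum_inter_left, he.sum_inter_right] at hsum
  linarith

theorem sum_coverMultiplicity_mul (he : IsSmallError U V F e) :
    ∑ j ∈ F, coverMultiplicity U V j * e j = 0 := by
  simp [coverMultiplicity, add_mul, ite_mul, Finset.sum_add_distrib, Finset.sum_ite_mem,
    he.sum_inter_left, he.sum_inter_right]

theorem sum_inter_le_five (he : IsSmallError U V F e) : ∑ j ∈ F ∩ (U ∩ V), e j ≤ 5 := by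
  have hsum : ∑ j ∈ F ∩ (U ∩ V), e j ≤ (F ∩ (U ∩ V)).card • (1 : ℝ) :=
    Finset.sum_le_card_nsmul _ _ _ fun j hj => he.le_one j (Finset.mem_inter.1 hj).1
  have hcard : ((F ∩ (U ∩ V)).card : ℝ) ≤ 5 := by exact_mod_cast he.card_inter_le
  simpa using hsum.trans (by simpa using hcard)

theorem sq_sum_mul_le (he : IsSmallError U V F e) {h : C → ℝ} {K : ℝ}
    (hK : ∑ j ∈ F, h j ^ 2 ≤ K) :
    (∑ j ∈ F, h j * e j) ^ 2 ≤ K * (3 / 2 + 1 / 30 * ∑ j ∈ F ∩ (U ∩ V), e j) :=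
  (Finset.sum_mul_sq_le_sq_mul_sq _ _ _).trans <|
    mul_le_mul hK he.sum_sq_le (by positivity) ((by positivity : (0 : ℝ) ≤ _).trans hK)

theorem sum_sq_le_six_mul (he : IsSmallError U V F e) {h : C → ℝ} {K : ℝ} (hK : 0 ≤ K)
    (hh : ∀ j ∈ F, h j ^ 2 ≤ K) : ∑ j ∈ F, h j ^ 2 ≤ 6 * K := by
  have hcard : (F.card : ℝ) ≤ 6 := by exact_mod_cast he.card_le
  calc ∑ j ∈ F, h j ^ 2 ≤ F.card * K := by simpa using Finset.sum_le_card_nsmul _ _ _ hh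
    _ ≤ 6 * K := by gcongr

/- Both estimates apply the Cauchy–Schwarz inequality to a shift of `w`; the shifts change the
weighted sum of the errors by a known multiple of `∑ j ∈ F ∩ (U ∩ V), e j`. The constant `1 / 30`
has to be positive for the first estimate to be strict, and less than `3 / 70` for the second. -/

theorem sum_mul_lt_two (he : IsSmallError U V F e) {w : C → ℝ} (hw : ∀ j, w j = 0 ∨ w j = 1) :
    ∑ j ∈ F, w j * e j < 2 := by
  by_contra! hlarge
  obtain hδ | hδ := le_or_gt 0 (∑ j ∈ F ∩ (U ∩ V), e j)
  · have hshift : ∑ j ∈ F, (w j - 1 / 2) * e j =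
        ∑ j ∈ F, w j * e j + 1 / 2 * ∑ j ∈ F ∩ (U ∩ V), e j := by
      simp only [sub_mul, Finset.sum_sub_distrib, ← Finset.mul_sum, he.sum_eq_neg]
      ring
    have hsq := he.sq_sum_mul_le (he.sum_sq_le_six_mul (h := fun j => w j - 1 / 2) (K := 1 / 4)
      (by norm_num) fun j _ => by obtain h | h := hw j <;> norm_num [h])
    rw [hshift] at hsq
    nlinarith
  · have hshift : ∑ j ∈ F, (w j - 1 / 3 * coverMultiplicity U V j) * e j = ∑ j ∈ F, w j * e j := by
      simp only [sub_mul, mul_assoc, Finset.sum_sub_distrib, ← Finset.mul_sum,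
        he.sum_coverMultiplicity_mul]
      ring
    have hsq := he.sq_sum_mul_le (he.sum_sq_le_six_mul
      (h := fun j => w j - 1 / 3 * coverMultiplicity U V j) (K := 4 / 9) (by norm_num)
      fun j hj => by
        have hUV := Finset.mem_union.1 (he.subset_union hj)
        obtain h | h := hw j <;> by_cases hU : j ∈ U <;> by_cases hV : j ∈ V <;>
          simp_all [coverMultiplicity] <;> norm_num)
    rw [hshift] at hsq
    nlinarith

theorem sum_mul_lt_three (he : IsSmallError U V F e) {w : C → ℝ} (hw : ∀ j, w j ∈ Set.Icc 0 2)
    (hw1 : ∀ j ∉ U ∩ V, w j ≤ 1) : ∑ j ∈ F, w j * e j < 3 := by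
  by_contra! hlarge
  have hshift : ∑ j ∈ F, (w j - 1 / 2 * coverMultiplicity U V j) * e j = ∑ j ∈ F, w j * e j := by
    simp only [sub_mul, mul_assoc, Finset.sum_sub_distrib, ← Finset.mul_sum,
      he.sum_coverMultiplicity_mul]
    ring
  have hpoint : ∀ j ∈ F, (w j - 1 / 2 * coverMultiplicity U V j) ^ 2 ≤
      1 / 4 + if j ∈ U ∩ V then 3 / 4 else 0 := by
    intro j hj
    have hUV := Finset.mem_union.1 (he.subset_union hj)
    obtain ⟨h0, h2⟩ := hw j
    have h1 := hw1 j
    by_cases hU : j ∈ U <;> by_cases hV : j ∈ V <;>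
      simp [coverMultiplicity, hU, hV] at hUV h1 ⊢ <;> nlinarith
  have hK : ∑ j ∈ F, (w j - 1 / 2 * coverMultiplicity U V j) ^ 2 ≤ 21 / 4 := by
    have h6 : (F.card : ℝ) ≤ 6 := by exact_mod_cast he.card_le
    have h5 : ((F ∩ (U ∩ V)).card : ℝ) ≤ 5 := by exact_mod_cast he.card_inter_le
    refine (Finset.sum_le_sum hpoint).trans ?_
    rw [Finset.sum_add_distrib, Finset.sum_ite_mem]
    simp only [Finset.sum_const, nsmul_eq_mul]
    linarith
  have hsq := he.sq_sum_mul_le hK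
  rw [hshift] at hsq
  nlinarith [he.sum_inter_le_five]

end IsSmallError

/-- The weights `w` and bounds `t` for which a common trace of `U` and `V` of weight at most `t` can
be found. Paths with a single inner vertex give weights of the first kind, longer ones weights of
the second kind. -/
inductive AdmissibleWeight (m : ℕ) (U V : Finset C) (w : C → ℤ) (t : ℤ) : Prop
  | zero_one (hw : ∀ j, w j = 0 ∨ w j = 1) (hsum : ∑ j ∈ U ∪ V, w j ≤ 2 * m + 1)
      (ht : (m : ℤ) + 1 ≤ t)
  | le_two (hw : ∀ j, w j ∈ Set.Icc 0 2) (hw1 : ∀ j ∉ U ∩ V, w j ≤ 1) (ht : (m : ℤ) + 2 ≤ t)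
      (hsum : ∑ j ∈ U ∪ V, w j + 1 - m ≤ t)

theorem AdmissibleWeight.exists_slack {m : ℕ} {U V : Finset C} {w : C → ℤ} {t : ℤ}
    (h : AdmissibleWeight m U V w t) :
    ∃ τ : ℝ, (∑ j ∈ U ∪ V, (w j : ℝ)) * (m / (2 * m + 1)) ≤ τ ∧
      ∀ F e, IsSmallError U V F e → τ + ∑ j ∈ F, w j * e j < t + 1 := by
  have : (0 : ℝ) ≤ m := m.cast_nonneg
  cases h with
  | zero_one hw hsum ht =>
    refine ⟨t - 1, ?_, fun F e he => ?_⟩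
    · rw [← mul_div_assoc, div_le_iff₀ (by positivity)]
      have hsum' : ∑ j ∈ U ∪ V, (w j : ℝ) ≤ 2 * m + 1 := by exact_mod_cast hsum
      have ht' : (m : ℝ) + 1 ≤ t := by exact_mod_cast ht
      nlinarith
    · have := he.sum_mul_lt_two (w := fun j => w j) fun j => by exact_mod_cast hw j
      linarith
  | le_two hw hw1 ht hsum =>
    refine ⟨t - 2, ?_, fun F e he => ?_⟩
    · rw [← mul_div_assoc, div_le_iff₀ (by positivity)]
      have hsum' : ∑ j ∈ U ∪ V, (w j : ℝ) + 1 - m ≤ t := by exact_mod_cast hsum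
      have ht' : (m : ℝ) + 2 ≤ t := by exact_mod_cast ht
      obtain _ | _ := le_total (∑ j ∈ U ∪ V, (w j : ℝ)) (2 * m + 1) <;> nlinarith
    · have := he.sum_mul_lt_three (w := fun j => w j)
        (fun j => ⟨by exact_mod_cast (hw j).1, by exact_mod_cast (hw j).2⟩)
        fun j hj => by exact_mod_cast hw1 j hj
      linarith

theorem exists_few_fractional {ι : Type*} [Fintype ι] (U V : Finset C) (w : ι → C → ℝ)
    {τ : ι → ℝ} {p : ℝ} (hp : p ∈ Set.Icc 0 1) (hτ : ∀ i, (∑ j ∈ U ∪ V, w i j) * p ≤ τ i) :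
    ∃ x : C → ℝ, (∀ j, x j ∈ Set.Icc 0 1) ∧ ∑ j ∈ U, x j = U.card * p ∧
      ∑ j ∈ V, x j = V.card * p ∧ (∀ i, ∑ j ∈ U ∪ V, w i j * x j ≤ τ i) ∧
      (fractionalSupport (U ∪ V) x).card ≤ Fintype.card ι + 2 ∧
      (fractionalSupport (U ∪ V) x ∩ (U ∩ V)).card ≤ Fintype.card ι + 1 := by
  let R : Option (Option ι) → (C → ℝ) →L[ℝ] ℝ := fun r =>
    r.elim (weightedSum 1 V) fun s => s.elim (weightedSum 1 U) fun i => weightedSum (w i) (U ∪ V)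
  let J : Option (Option ι) → Set ℝ := fun r =>
    r.elim {(V.card * p : ℝ)} fun s => s.elim {(U.card * p : ℝ)} fun i => Set.Iic (τ i)
  have hJ : ∀ r, IsClosed (J r) := by
    rintro (_ | _ | i)
    exacts [isClosed_singleton, isClosed_singleton, isClosed_Iic]
  have hstart : (fun _ => p) ∈ boxSection (0 : C → ℝ) 1 R J := by
    refine mem_boxSection.2 ⟨⟨fun _ => hp.1, fun _ => hp.2⟩, ?_⟩
    rintro (_ | _ | i)
    · simp [R, J]
    · simp [R, J]
    · simpa [R, J, ← Finset.sum_mul] using hτ i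
  obtain ⟨x, hx⟩ := (isCompact_boxSection _ _ R hJ).extremePoints_nonempty ⟨_, hstart⟩
  obtain ⟨hbox, hrow⟩ := mem_boxSection.1 hx.1
  have hF : ∀ j ∈ fractionalSupport (U ∪ V) x, (0 : C → ℝ) j < x j ∧ x j < (1 : C → ℝ) j :=
    fun j hj => (Finset.mem_filter.1 hj).2
  refine ⟨x, fun j => ⟨hbox.1 j, hbox.2 j⟩, by simpa [R, J] using hrow (some none),
    by simpa [R, J] using hrow none, fun i => by simpa [R, J] using hrow (some (some i)),
    by simpa using card_le_of_mem_extremePoints_boxSection hx hF, ?_⟩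
  -- A vector supported on `U ∩ V` has equal sums over `U` and `V`, so one row is redundant.
  rw [← Fintype.card_option]
  refine card_le_of_mem_extremePoints_boxSection_of_redundant some hx
    (fun j hj => hF j (Finset.mem_inter.1 hj).1) fun g hgF hgR => ?_
  have hsum : ∀ W, U ∩ V ⊆ W → ∑ j ∈ W, g j = ∑ j ∈ U ∩ V, g j := fun W hW =>
    (Finset.sum_subset hW fun j _ hj => hgF j fun h => hj (Finset.mem_inter.1 h).2).symm
  have hU : ∑ j ∈ U, g j = 0 := by simpa [R] using hgR none
  rintro (_ | s)
  · simpa [R, hsum V Finset.inter_subset_right, hsum U Finset.inter_subset_left] using hU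
  · exact hgR s

theorem exists_isSmallError_rounding {U V : Finset C} {x : C → ℝ} (hx : ∀ j, x j ∈ Set.Icc 0 1)
    {p q : ℕ} (hU : ∑ j ∈ U, x j = p) (hV : ∑ j ∈ V, x j = q)
    (hF : (fractionalSupport (U ∪ V) x).card ≤ 6)
    (hF' : (fractionalSupport (U ∪ V) x ∩ (U ∩ V)).card ≤ 5) :
    ∃ y : C → ℤ, (∀ j, y j = 0 ∨ y j = 1) ∧ ∑ j ∈ U, y j = p ∧ ∑ j ∈ V, y j = q ∧
      (∀ j ∈ U ∪ V, j ∉ fractionalSupport (U ∪ V) x → (y j : ℝ) = x j) ∧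
      IsSmallError U V (fractionalSupport (U ∪ V) x) fun j => y j - x j := by
  obtain ⟨y, hy, hyU, hyV, hdist⟩ := exists_close_rounding hx hU hV (1 / 30)
  set F := fractionalSupport (U ∪ V) x
  have hfix : ∀ j ∈ U ∪ V, j ∉ F → (y j : ℝ) = x j := fun j => eq_of_floor_le_of_le_ceil hx hy
  have hy01 : ∀ j, y j = 0 ∨ y j = 1 := fun j =>
    eq_zero_or_eq_one_of_floor_le_of_le_ceil (hx j) (hy j)
  have hinter : ∀ W ⊆ U ∪ V, ∑ j ∈ F ∩ W, ((y j : ℝ) - x j) = ∑ j ∈ W, ((y j : ℝ) - x j) :=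
    fun W hW => Finset.sum_subset Finset.inter_subset_right fun j hj hjF =>
      sub_eq_zero.2 (hfix j (hW hj) fun h => hjF (Finset.mem_inter.2 ⟨h, hj⟩))
  have hyU' : ∑ j ∈ U, (y j : ℝ) = p := by exact_mod_cast hyU
  have hyV' : ∑ j ∈ V, (y j : ℝ) = q := by exact_mod_cast hyV
  refine ⟨y, hy01, hyU, hyV, hfix, Finset.filter_subset _ _,
    fun j _ => ?_, ?_, ?_, hF, hF', ?_⟩
  · have : (y j : ℝ) ≤ 1 := by obtain h | h := hy01 j <;> simp [h]
    linarith [(hx j).1]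
  · rw [hinter U Finset.subset_union_left, Finset.sum_sub_distrib, hyU', hU, sub_self]
  · rw [hinter V Finset.subset_union_right, Finset.sum_sub_distrib, hyV', hV, sub_self]
  · rw [hinter _ Finset.inter_subset_union]
    have hF6 : (F.card : ℝ) ≤ 6 := by exact_mod_cast hF
    calc ∑ j ∈ F, ((y j : ℝ) - x j) ^ 2 ≤ ∑ j ∈ U ∪ V, ((y j : ℝ) - x j) ^ 2 :=
          Finset.sum_le_sum_of_subset_of_nonneg (Finset.filter_subset _ _) fun _ _ _ => sq_nonneg _
      _ ≤ _ := by linarith [sum_mul_one_sub_le (E := U ∪ V) hx]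

theorem exists_light_subset {ι : Type*} [Fintype ι] (hι : Fintype.card ι ≤ 4) {m : ℕ}
    {U V : Finset C} (hU : U.card = 2 * m + 1) (hV : V.card = 2 * m + 1) {w : ι → C → ℤ} {t : ι → ℤ}
    (h : ∀ i, AdmissibleWeight m U V (w i) (t i)) :
    ∃ S ⊆ U ∪ V, (S ∩ U).card = m ∧ (S ∩ V).card = m ∧ ∀ i, ∑ j ∈ S, w i j ≤ t i := by
  choose τ hstart hround using fun i => (h i).exists_slack
  have hm : (m : ℝ) / (2 * m + 1) ∈ Set.Icc 0 1 :=
    ⟨by positivity, div_le_one_of_le₀ (by linarith [m.cast_nonneg (α := ℝ)]) (by positivity)⟩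
  have hcard : ((2 * m + 1 : ℕ) : ℝ) * (m / (2 * m + 1)) = m := by
    push_cast
    field_simp
  obtain ⟨x, hx, hxU, hxV, hxw, hF, hF'⟩ :=
    exists_few_fractional U V (fun i j => (w i j : ℝ)) hm hstart
  rw [hU, hcard] at hxU
  rw [hV, hcard] at hxV
  obtain ⟨y, hy01, hyU, hyV, hfix, herr⟩ :=
    exists_isSmallError_rounding hx hxU hxV (by omega) (by omega)
  set F := fractionalSupport (U ∪ V) x
  have hsum : ∀ f : C → ℤ, ∀ W, ∑ j ∈ W.filter (y · = 1), f j = ∑ j ∈ W, f j * y j := by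
    intro f W
    rw [Finset.sum_filter]
    exact Finset.sum_congr rfl fun j _ => by obtain h | h := hy01 j <;> simp [h]
  have htrace : ∀ W ⊆ U ∪ V, (((U ∪ V).filter (y · = 1) ∩ W).card : ℤ) = ∑ j ∈ W, y j := by
    intro W hW
    rw [Finset.filter_inter, Finset.inter_eq_right.2 hW]
    simpa using hsum 1 W
  refine ⟨(U ∪ V).filter (y · = 1), Finset.filter_subset _ _, ?_, ?_, fun i => ?_⟩
  · exact_mod_cast (htrace U Finset.subset_union_left).trans hyU
  · exact_mod_cast (htrace V Finset.subset_union_right).trans hyV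
  · have hsplit : ∑ j ∈ U ∪ V, (w i j : ℝ) * y j =
        ∑ j ∈ U ∪ V, (w i j : ℝ) * x j + ∑ j ∈ F, (w i j : ℝ) * (y j - x j) := by
      rw [Finset.sum_subset herr.subset_union fun j hj hjF => by rw [hfix j hj hjF]; simp,
        ← Finset.sum_add_distrib]
      exact Finset.sum_congr rfl fun j _ => by ring
    have hlt : ∑ j ∈ U ∪ V, (w i j : ℝ) * y j < t i + 1 := by
      linarith [hxw i, hround i F _ herr]
    rw [hsum, ← Int.lt_add_one_iff]
    exact_mod_cast hlt

end CommonTrace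

section Theta

variable {C : Type w}

theorem exists_thetaGraph_colouring {q : ℕ} {k : Fin q → ℕ} {m : ℕ}
    {L : ThetaVertex k → Finset C} {A B : Finset C} (hA : A ⊆ L .u) (hB : B ⊆ L .v)
    (hAm : A.card = m) (hBm : B.card = m)
    (h : ∀ i, PathColourable m A B (k i - 1) fun j => L (thetaPath k i (j + 1))) :
    ∃ φ : ThetaVertex k → Finset C, (∀ x, (φ x).card = m) ∧ (∀ x, φ x ⊆ L x) ∧
      ∀ x y, (thetaGraph k).Adj x y → Disjoint (φ x) (φ y) := by
  choose ψ hstart hend hlist hdisj using h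
  let φ : ThetaVertex k → Finset C := fun x => match x with
    | .u => A
    | .v => B
    | .inner i j => ψ i (j + 1)
  have hpath : ∀ i j, j ≤ k i → φ (thetaPath k i j) = ψ i j := by
    intro i j hj
    obtain rfl | hj0 := j.eq_zero_or_pos
    · exact (hstart i).symm
    · rw [thetaPath, if_neg hj0.ne']
      split_ifs with hlt
      · exact congrArg (ψ i) (Nat.sub_add_cancel hj0)
      · obtain rfl : j = k i - 1 + 1 := by omega
        exact (hend i).symm
  have hedge : ∀ x y, (∃ i, ∃ j < k i, x = thetaPath k i j ∧ y = thetaPath k i (j + 1)) →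
      Disjoint (φ x) (φ y) := by
    rintro x y ⟨i, j, hj, rfl, rfl⟩
    rw [hpath i j hj.le, hpath i (j + 1) hj]
    exact hdisj i j (by omega)
  refine ⟨φ, ?_, ?_, fun x y hxy => ?_⟩
  · rintro (_ | _ | ⟨i, j⟩)
    exacts [hAm, hBm, (hlist i j j.2).2]
  · rintro (_ | _ | ⟨i, j⟩)
    exacts [hA, hB, by simpa [thetaPath, φ] using (hlist i j j.2).1]
  · rw [thetaGraph, SimpleGraph.fromRel_adj] at hxy
    exact hxy.2.elim (hedge x y) fun h => (hedge y x h).symm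

theorem IsChoosable.of_iso {V : Type u} {W : Type*} {G : SimpleGraph V} {H : SimpleGraph W}
    (e : G ≃g H) {a b : ℕ} (h : IsChoosable.{_, w} H a b) : IsChoosable.{u, w} G a b := by
  intro C L hL
  obtain ⟨φ, hcard, hsub, hdisj⟩ := h C (L ∘ e.symm) fun _ => hL _
  exact ⟨φ ∘ e, fun _ => hcard _, fun v => by simpa using hsub (e v),
    fun x y hxy => hdisj _ _ (e.map_adj_iff.2 hxy)⟩

variable [DecidableEq C]

theorem exists_admissibleWeight_one {m : ℕ} (U V : Finset C) {L : ℕ → Finset C}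
    (hL : (L 0).card = 2 * m + 1) :
    ∃ (w : C → ℤ) (t : ℤ), AdmissibleWeight m U V w t ∧
      ∀ S ⊆ U ∪ V, ∑ j ∈ S, w j ≤ t → PathColourable m (S ∩ U) (S ∩ V) 1 L := by
  refine ⟨fun j => if j ∈ L 0 then 1 else 0, m + 1, .zero_one (fun j => ?_) ?_ le_rfl,
    fun S hS hsum => pathColourable_one ?_⟩
  · split_ifs <;> simp
  · have := Finset.card_le_card (Finset.inter_subset_right (s₁ := U ∪ V) (s₂ := L 0))
    simp only [Finset.sum_ite_mem, Finset.sum_const, nsmul_eq_mul, mul_one]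
    omega
  · rw [← Finset.inter_union_distrib_left, Finset.inter_eq_left.2 hS, Finset.inter_comm]
    simp only [Finset.sum_ite_mem, Finset.sum_const, nsmul_eq_mul, mul_one] at hsum
    omega

theorem card_inter_add_card_le (U : Finset C) {X Y : Finset C} (h : X ⊆ Y) :
    (U ∩ Y).card + X.card ≤ (U ∩ X).card + Y.card := by
  have hX := Finset.card_inter_add_card_sdiff X U
  have hY := Finset.card_inter_add_card_sdiff Y U
  have hle := Finset.card_le_card (Finset.sdiff_subset_sdiff h (le_refl U))
  rw [Finset.inter_comm U, Finset.inter_comm U]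
  omega

theorem exists_admissibleWeight_of_odd {m n : ℕ} (hn : Odd n) (U V : Finset C) {L : ℕ → Finset C}
    (hL : ∀ j, (L j).card = 2 * m + 1) :
    ∃ (w : C → ℤ) (t : ℤ), AdmissibleWeight m U V w t ∧
      ∀ S ⊆ U ∪ V, (S ∩ U).card = m → (S ∩ V).card = m → ∑ j ∈ S, w j ≤ t →
        PathColourable m (S ∩ U) (S ∩ V) n L := by
  obtain ⟨a, rfl⟩ := hn
  obtain rfl | ha := a.eq_zero_or_pos
  · obtain ⟨w, t, hw, hpath⟩ := exists_admissibleWeight_one U V (hL 0)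
    exact ⟨w, t, hw, fun S hS _ _ => hpath S hS⟩
  obtain ⟨X, Y, Λ, t, hYV, hΛV, hΛX, htm, ht, hpath⟩ :=
    exists_pathColourable_condition_odd V ha fun j => (hL j).ge
  let w : C → ℤ := fun j => (if j ∈ U ∩ X then 1 else 0) + (if j ∈ Y then 1 else 0) -
    if j ∈ U ∩ Λ then 1 else 0
  have hsum : ∀ S, ∑ j ∈ S, w j =
      ((S ∩ (U ∩ X)).card : ℤ) + (S ∩ Y).card - (S ∩ (U ∩ Λ)).card := by
    simp [w, Finset.sum_add_distrib, Finset.sum_sub_distrib, -Finset.mem_inter]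
  refine ⟨w, t, .le_two (fun j => ?_) (fun j hj => ?_) htm ?_, fun S _ hA hB hle => ?_⟩
  · have := @hΛX j
    simp only [w, Set.mem_Icc]
    grind
  · have := @hYV j
    simp only [w]
    grind
  · have hY : (U ∪ V) ∩ Y = Y := Finset.inter_eq_right.2 (hYV.trans Finset.subset_union_right)
    have hU : ∀ Z, (U ∪ V) ∩ (U ∩ Z) = U ∩ Z := fun Z =>
      Finset.inter_eq_right.2 (Finset.inter_subset_left.trans Finset.subset_union_left)
    have hX := card_inter_add_card_le U hΛX
    rw [hsum, hY, hU, hU]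
    omega
  · refine hpath _ _ hA.le hB.le Finset.inter_subset_right ?_
    have hY : S ∩ V ∩ Y = S ∩ Y := by rw [Finset.inter_assoc, Finset.inter_eq_right.2 hYV]
    have hΛ : S ∩ U ∩ (S ∩ V) ∩ Λ = S ∩ (U ∩ Λ) := by
      rw [← Finset.inter_inter_distrib_left, Finset.inter_assoc, Finset.inter_assoc,
        Finset.inter_eq_right.2 hΛV]
    rwa [hY, hΛ, Finset.inter_assoc, ← hsum]

theorem isChoosable_thetaGraph_of_even {q : ℕ} (hq : q ≤ 4) {k : Fin q → ℕ}
    (hk : ∀ i, Even (k i) ∧ 0 < k i) (m : ℕ) :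
    IsChoosable.{0, w} (thetaGraph k) (2 * m + 1) m := by
  classical
  intro C L hL
  have hodd : ∀ i, Odd (k i - 1) := fun i => Nat.Even.sub_odd (hk i).2 (hk i).1 odd_one
  choose w t hw hpath using fun i => exists_admissibleWeight_of_odd (hodd i) (L .u) (L .v)
    (L := fun j => L (thetaPath k i (j + 1))) fun j => hL _
  obtain ⟨S, hS, hSu, hSv, hlight⟩ :=
    exists_light_subset (by simpa using hq) (hL .u) (hL .v) hw
  exact exists_thetaGraph_colouring Finset.inter_subset_right
    Finset.inter_subset_right hSu hSv fun i => hpath i S hS hSu hSv (hlight i)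

theorem isChoosable_thetaGraph_of_odd {q : ℕ} (hq : q ≤ 3) {k : Fin q → ℕ} (hk : ∀ i, Odd (k i))
    (m : ℕ) : IsChoosable.{0, w} (thetaGraph k) (2 * m + 1) m := by
  classical
  intro C L hL
  have heven : ∀ i, k i - 1 = 2 * (k i / 2) := fun i => by
    have := Nat.odd_iff.1 (hk i)
    omega
  choose X Y hpath using fun i => exists_pathColourable_condition_even (L .v) (k i / 2)
    (L := fun j => L (thetaPath k i (j + 1))) fun j => (hL _).ge
  obtain ⟨A, B, hA, hB, hAm, hBm, hAB, hXY⟩ :=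
    exists_disjoint_branch_colours (by simpa using hq) (hL .u) (hL .v) X Y
  refine exists_thetaGraph_colouring hA hB hAm hBm fun i => ?_
  rw [heven i]
  exact hpath i A B hAm.le hBm.le hB hAB (hXY i)

end Theta

theorem theorem1p3_general {V : Type u} (G : SimpleGraph V)
    (hG : ∃ (q : ℕ) (k : Fin q → ℕ), Nonempty (G ≃g thetaGraph k) ∧
      (q ≤ 4 ∧ (∀ i, Even (k i) ∧ 0 < k i) ∨ q ≤ 3 ∧ ∀ i, Odd (k i))) (m : ℕ) :
    IsChoosable.{u, w} G (2 * m + 1) m := by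
  obtain ⟨q, k, ⟨e⟩, ⟨hq, hk⟩ | ⟨hq, hk⟩⟩ := hG
  · exact (isChoosable_thetaGraph_of_even hq hk m).of_iso e
  · exact (isChoosable_thetaGraph_of_odd hq hk m).of_iso e

theorem theorem1p3 {V : Type u} (G : SimpleGraph V)
    (hG : (∃ r s t : ℕ, 1 < r ∧ 1 < s ∧ 1 < t ∧
            Nonempty (G ≃g thetaGraph ![2 * r, 2 * s, 2 * t])) ∨
          (∃ r s t : ℕ, 0 < r ∧ 0 < s ∧ 0 < t ∧
            Nonempty (G ≃g thetaGraph ![2 * r + 1, 2 * s + 1, 2 * t + 1])) ∨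
          (∃ t : ℕ, 1 ≤ t ∧ Nonempty (G ≃g thetaGraph ![2, 2, 2, 2 * t])))
    (m : ℕ) (hm : 0 < m) :
    IsChoosable.{u, w} G (2 * m + 1) m := by
  refine theorem1p3_general G ?_ m
  obtain ⟨r, s, t, hr, hs, ht, h⟩ | ⟨r, s, t, -, -, -, h⟩ | ⟨t, ht, h⟩ := hG
  · exact ⟨3, _, h, .inl (by simp [Fin.forall_fin_succ]; omega)⟩
  · exact ⟨3, _, h, .inr (by simp [Fin.forall_fin_succ])⟩
  · exact ⟨4, _, h, .inl (by simp [Fin.forall_fin_succ]; omega)⟩
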